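/- Let $n \ge 1$. A (convex) polytope in $\mathbb{R}^n$ is a bounded intersection of finitely many closed halfspaces. A point $x$ is a vertex of a polytope $P$ if $\{x\}$ is a face of $P$, that is, if some linear functional attains its maximum over $P$ at $x$ and at no other point of $P$. A polytopal tiling of $\mathbb{R}^n$ is a family $\mathcal{T}=(T_i)_{i\in I}$ of polytopes with non-empty interior whose union is $\mathbb{R}^n$ and whose interiors are pairwise disjoint; it is locally finite if each bounded subset of $\mathbb{R}^n$ intersects only finitely many of the tiles $T_i$. Theorem (Lonely vertex theorem). Let $\mathcal{T}$ be a locally finite polytopal tiling of $\mathbb{R}^n$. Then there is no point $x \in \mathbb{R}^n$ that is a vertex of exactly one tile of $\mathcal{T}$; that is, every point of $\mathbb{R}^n$ is a vertex of no tile or of at least two tiles. -/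

import Mathlib

/-- A closed halfspace of `ℝⁿ`: the set `{x | ⟪a, x⟫ ≤ b}` for some `a ≠ 0` and some real `b`. -/
def IsClosedHalfspace {n : ℕ} (H : Set (EuclideanSpace ℝ (Fin n))) : Prop :=
  ∃ (a : EuclideanSpace ℝ (Fin n)) (b : ℝ), a ≠ 0 ∧ H = {x | inner ℝ a x ≤ b}

/-- A (convex) polyhedron: the intersection of finitely many closed halfspaces. -/
def IsPolyhedron {n : ℕ} (P : Set (EuclideanSpace ℝ (Fin n))) : Prop :=
  ∃ 𝓗 : Set (Set (EuclideanSpace ℝ (Fin n))),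
    𝓗.Finite ∧ (∀ H ∈ 𝓗, IsClosedHalfspace H) ∧ P = ⋂₀ 𝓗

/-- A (convex) polytope: a bounded polyhedron. -/
def IsPolytope {n : ℕ} (P : Set (EuclideanSpace ℝ (Fin n))) : Prop :=
  IsPolyhedron P ∧ Bornology.IsBounded P

/-- `x` is a (geometric) vertex of `P`: the set `{x}` is a zero-dimensional face of `P`, that is,
some linear functional attains its maximum over `P` at `x` and nowhere else. -/
def IsVertex {n : ℕ} (P : Set (EuclideanSpace ℝ (Fin n))) (x : EuclideanSpace ℝ (Fin n)) : Prop :=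
  x ∈ P.exposedPoints ℝ

/-- A polytopal tiling of `ℝⁿ`: a family of `n`-dimensional convex polytopes which covers `ℝⁿ`
and whose members have pairwise disjoint interiors. -/
structure IsPolytopalTiling {n : ℕ} {ι : Type*} (T : ι → Set (EuclideanSpace ℝ (Fin n))) :
    Prop where
  isPolytope : ∀ i, IsPolytope (T i)
  /-- The tiles are full-dimensional. -/
  interior_nonempty : ∀ i, (interior (T i)).Nonempty
  covering : ⋃ i, T i = Set.univ
  packing : Pairwise fun i j => Disjoint (interior (T i)) (interior (T j))

/-- A locally finite polytopal tiling: each bounded set meets only finitely many tiles. -/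
def IsLocallyFiniteTiling {n : ℕ} {ι : Type*} (T : ι → Set (EuclideanSpace ℝ (Fin n))) : Prop :=
  IsPolytopalTiling T ∧
    ∀ U : Set (EuclideanSpace ℝ (Fin n)), Bornology.IsBounded U → {i | (T i ∩ U).Nonempty}.Finite

/-! A signed count around `x` gives a contradiction if exactly one tile `T i₀` has `x` as a vertex.
Near `x` each tile through `x` is its tangent cone. A complete flag of faces of the cone of `T i₀`
yields independent directions `y j`, and each sign vector `s` gives a curve `x + ∑ ε ^ (j + 1) * s j
* y j`. For small `ε > 0` a linear functional has on its displacement from `x` the sign of its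
leading entry along the signed flag, so each curve eventually lies inside exactly one tile
(`existsUnique_containsGerm`).

Weight `s` by `∏ j, s j`. The total weight is `0` because `n ≥ 1`. A tile without vertex at `x` has
a line in its cone, hence is indifferent to some sign (`exists_flip_of_line`) and contributes `0`.
The tile `T i₀` contains only the curve with all signs positive (`containsGerm_iff_of_flag`) and
contributes `1`. So `0 = 1`. -/

open Filter Topology Module

/-! ### Lexicographic signs and small perturbations -/

section Lex

/-- The first nonzero entry of `c` is negative. -/
def LexNeg {n : ℕ} (c : Fin n → ℝ) : Prop :=
  ∃ j, (∀ i < j, c i = 0) ∧ c j < 0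

/-- After division by `ε ^ (j + 1)`, with `j` the leading index, a polynomial in `ε` with value `c j
< 0` at `0` remains. -/
theorem LexNeg.eventually_sum_neg {n : ℕ} {c : Fin n → ℝ} (h : LexNeg c) :
    ∀ᶠ ε : ℝ in 𝓝[>] 0, ∑ i : Fin n, ε ^ ((i : ℕ) + 1) * c i < 0 := by
  obtain ⟨j, hj, hneg⟩ := h
  let g : ℝ → ℝ := fun ε => ∑ i, if i < j then 0 else ε ^ ((i : ℕ) - (j : ℕ)) * c i
  have hg : Continuous g := by
    refine continuous_finsetSum _ fun i _ => ?_
    split_ifs <;> fun_prop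
  have hg0 : g 0 = c j := by
    refine (Finset.sum_eq_single j ?_ (by simp)).trans (by simp)
    intro i _ hij
    split_ifs with h
    · rfl
    · have : (i : ℕ) - (j : ℕ) ≠ 0 := by
        have : (i : ℕ) ≠ j := fun e => hij (Fin.ext e)
        have : ¬ (i : ℕ) < j := h
        omega
      simp [this]
  have hev : ∀ᶠ ε in 𝓝[>] (0 : ℝ), g ε < 0 :=
    nhdsWithin_le_nhds (hg.continuousAt.eventually_lt continuousAt_const (by simpa [hg0]))
  filter_upwards [hev, self_mem_nhdsWithin] with ε hε hpos
  have hpos : 0 < ε := hpos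
  have hsum : ∑ i : Fin n, ε ^ ((i : ℕ) + 1) * c i = ε ^ ((j : ℕ) + 1) * g ε := by
    rw [Finset.mul_sum]
    refine Finset.sum_congr rfl fun i _ => ?_
    split_ifs with h
    · simp [hj i h]
    · have : ¬ (i : ℕ) < j := h
      rw [← mul_assoc, ← pow_add]
      congr 2
      omega
  rw [hsum]
  exact mul_neg_of_pos_of_neg (by positivity) hε

theorem lexNeg_or_lexNeg_neg {n : ℕ} {c : Fin n → ℝ} (h : c ≠ 0) :
    LexNeg c ∨ LexNeg (-c) := by
  classical
  obtain ⟨j, hj, hmin⟩ := Finset.exists_min_image (Finset.univ.filter fun i => c i ≠ 0) id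
    (by obtain ⟨i, hi⟩ := Function.ne_iff.1 h; exact ⟨i, by simpa using hi⟩)
  have hzero : ∀ i < j, c i = 0 := by
    intro i hi
    by_contra hne
    exact absurd (hmin i (by simpa using hne)) (not_le.2 hi)
  rcases lt_or_gt_of_ne (show c j ≠ 0 by simpa using hj) with hlt | hgt
  · exact Or.inl ⟨j, hzero, hlt⟩
  · exact Or.inr ⟨j, fun i hi => by simp [hzero i hi], by simpa using hgt⟩

theorem LexNeg.eventually_sum_pos {n : ℕ} {c : Fin n → ℝ} (h : LexNeg (-c)) :
    ∀ᶠ ε : ℝ in 𝓝[>] 0, 0 < ∑ i : Fin n, ε ^ ((i : ℕ) + 1) * c i := by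
  filter_upwards [h.eventually_sum_neg] with ε hε
  simpa using hε

/-- Changing the sign of an entry which is not the leading one does not affect `LexNeg`. -/
theorem LexNeg.of_eq_off {n : ℕ} {c d : Fin n → ℝ} {m : Fin n} (h : LexNeg c)
    (hm : (∀ i < m, c i = 0) → c m = 0) (hd : ∀ i ≠ m, d i = c i)
    (hdm : c m = 0 → d m = 0) : LexNeg d := by
  obtain ⟨j, hj, hneg⟩ := h
  have hjm : j ≠ m := by
    rintro rfl
    exact hneg.ne (hm hj)
  refine ⟨j, fun i hi => ?_, by rwa [hd j hjm]⟩
  by_cases him : i = m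
  · subst him
    exact hdm (hj i hi)
  · rw [hd i him, hj i hi]

end Lex

/-! ### Cancellation of signed counts -/

section Signs

/-- Flipping coordinate `m` is a fixed-point-free involution that preserves `P` and negates the
product, so terms cancel in pairs. -/
theorem sum_sign_eq_zero_of_flip {n : ℕ} (m : Fin n) (P : (Fin n → ℤˣ) → Prop) [DecidablePred P]
    (h : ∀ s, P s → P (Function.update s m (-s m))) :
    ∑ s, (if P s then ((∏ j, s j : ℤˣ) : ℤ) else 0) = 0 := by
  have hinv : ∀ s : Fin n → ℤˣ, Function.update (Function.update s m (-s m)) m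
      (-(Function.update s m (-s m)) m) = s := by
    intro s; simp
  have hiff : ∀ s, P (Function.update s m (-s m)) ↔ P s := fun s =>
    ⟨fun hs => by simpa only [hinv] using h _ hs, h s⟩
  have hprod : ∀ s : Fin n → ℤˣ, ∏ j, Function.update s m (-s m) j = -∏ j, s j := by
    intro s
    rw [Finset.prod_update_of_mem (Finset.mem_univ m), neg_mul,
      ← Finset.mul_prod_erase Finset.univ s (Finset.mem_univ m), Finset.erase_eq]
  refine Finset.sum_involution (fun s _ => Function.update s m (-s m)) ?_ ?_ ?_ ?_
  · intro s _
    simp only [hiff, hprod]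
    split_ifs <;> simp
  · intro s _ _ he
    have := congrFun he m
    simp only [Function.update_self] at this
    rcases Int.units_eq_one_or (s m) with e | e <;> rw [e] at this <;> exact absurd this (by decide)
  · intro s _; exact Finset.mem_univ _
  · intro s _; exact hinv s

end Signs

/-! ### Extremal rays and flags of polyhedral cones -/

section Normals

variable {E : Type*} [NormedAddCommGroup E] [InnerProductSpace ℝ E]

theorem det_inner_ne_zero_of_triangular {m : ℕ} {a y : Fin m → E}
    (h0 : ∀ j, ∀ i < j, inner ℝ (a j) (y i) = 0) (hd : ∀ j, inner ℝ (a j) (y j) ≠ 0) :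
    (Matrix.of fun j i => inner ℝ (a j) (y i)).det ≠ 0 := by
  have htri : (Matrix.of fun j i => inner ℝ (a j) (y i)).IsUpperTriangular :=
    fun j i hij => h0 j i hij
  rw [Matrix.det_of_isUpperTriangular htri]
  exact Finset.prod_ne_zero_iff.2 fun j _ => hd j

theorem linearIndependent_left_of_triangular {m : ℕ} {a y : Fin m → E}
    (h0 : ∀ j, ∀ i < j, inner ℝ (a j) (y i) = 0) (hd : ∀ j, inner ℝ (a j) (y j) ≠ 0) :
    LinearIndependent ℝ a := by
  rw [Fintype.linearIndependent_iff]
  intro c hc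
  refine congrFun (Matrix.eq_zero_of_vecMul_eq_zero (det_inner_ne_zero_of_triangular h0 hd) ?_)
  ext i
  have := congrArg (fun v => inner ℝ v (y i)) hc
  simpa [sum_inner, inner_smul_left, Matrix.vecMul, dotProduct] using this

theorem linearIndependent_right_of_triangular {m : ℕ} {a y : Fin m → E}
    (h0 : ∀ j, ∀ i < j, inner ℝ (a j) (y i) = 0) (hd : ∀ j, inner ℝ (a j) (y j) ≠ 0) :
    LinearIndependent ℝ y := by
  rw [Fintype.linearIndependent_iff]
  intro c hc
  refine congrFun (Matrix.eq_zero_of_mulVec_eq_zero (det_inner_ne_zero_of_triangular h0 hd) ?_)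
  ext j
  have := congrArg (fun v => inner ℝ (a j) v) hc
  simpa [inner_sum, inner_smul_right, Matrix.mulVec, dotProduct, mul_comm] using this

theorem eq_zero_of_inner_eq_zero_of_linearIndependent [FiniteDimensional ℝ E] {m : ℕ}
    (hm : finrank ℝ E = m) {a : Fin m → E} (ha : LinearIndependent ℝ a) {u : E}
    (hu : ∀ j, inner ℝ (a j) u = 0) : u = 0 := by
  have hspan := ha.span_eq_top_of_card_eq_finrank' (by simp [hm])
  have hmem : u ∈ (Submodule.span ℝ (Set.range a))ᗮ := by
    rw [Submodule.mem_orthogonal]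
    intro v hv
    induction hv using Submodule.span_induction with
    | mem v hv => obtain ⟨j, rfl⟩ := hv; exact hu j
    | zero => simp
    | add v w _ _ hv hw => rw [inner_add_left, hv, hw, add_zero]
    | smul r v _ hv => rw [inner_smul_left, hv, mul_zero]
  simpa [hspan] using hmem

/-- A vector along which all constraints of a pointed cone are satisfied and the tight ones span a
hyperplane in the span of all constraints: a generator of an extremal ray. -/
theorem exists_extremal_direction [FiniteDimensional ℝ E] (A : Finset E) (hA : A.Nonempty)
    (hz : ∃ z : E, ∀ a ∈ A, inner ℝ a z < 0) :
    ∃ y : E, (∀ a ∈ A, inner ℝ a y ≤ 0) ∧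
      finrank ℝ (Submodule.span ℝ {a : E | a ∈ A ∧ inner ℝ a y = 0}) + 1 =
        finrank ℝ (Submodule.span ℝ (A : Set E)) ∧ ∃ a ∈ A, inner ℝ a y < 0 := by
  classical
  obtain ⟨z, hz⟩ := hz
  obtain ⟨az, haz⟩ := hA
  let F : Set E := {y | (∀ a ∈ A, inner ℝ a y ≤ 0) ∧ ∃ a ∈ A, inner ℝ a y < 0}
  let N : E → ℕ := fun y => (A.filter fun a => inner ℝ a y ≠ 0).card
  have hF : F.Nonempty := ⟨z, fun a ha => (hz a ha).le, az, haz, hz az haz⟩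
  -- An extremal direction is a nonzero point of the cone, modulo its lines, with as few slack
  -- constraints as possible.
  obtain ⟨y, hyF, hmin⟩ : ∃ y ∈ F, ∀ w ∈ F, N y ≤ N w := by
    obtain ⟨y, hy, e⟩ := Nat.sInf_mem (hF.image N)
    exact ⟨y, hy, fun w hw => e ▸ Nat.sInf_le ⟨w, hw, rfl⟩⟩
  obtain ⟨hy, a₀, ha₀, hya₀⟩ := hyF
  refine ⟨y, hy, ?_, a₀, ha₀, hya₀⟩
  set B : Set E := {a : E | a ∈ A ∧ inner ℝ a y = 0}
  have hBA : Submodule.span ℝ B ≤ Submodule.span ℝ (A : Set E) :=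
    Submodule.span_mono fun a ha => ha.1
  have hker : ∀ v ∈ Submodule.span ℝ B, inner ℝ v y = 0 := by
    intro v hv
    induction hv using Submodule.span_induction with
    | mem v hv => exact hv.2
    | zero => simp
    | add v w _ _ hv hw => rw [inner_add_left, hv, hw, add_zero]
    | smul r v _ hv => rw [inner_smul_left, hv, mul_zero]
  have hlt : Submodule.span ℝ B < Submodule.span ℝ (A : Set E) :=
    lt_of_le_of_ne hBA fun e => hya₀.ne (hker a₀ (e ▸ Submodule.subset_span ha₀))
  refine le_antisymm (Submodule.finrank_lt_finrank_of_lt hlt) ?_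
  -- Otherwise some `u` is orthogonal to `a₀` and to all tight normals but not to `a₁`. Moving along
  -- `u` until the first new constraint becomes tight (ratio test, with step `t`) keeps `a₀` slack
  -- and contradicts minimality.
  have hle : Submodule.span ℝ (A : Set E) ≤ Submodule.span ℝ {a₀} ⊔ Submodule.span ℝ B := by
    rw [Submodule.span_le]
    intro a₁ ha₁
    by_contra hnot
    set K := Submodule.span ℝ {a₀} ⊔ Submodule.span ℝ B
    obtain ⟨u, huK, hu⟩ : ∃ u ∈ Kᗮ, 0 < inner ℝ a₁ u := by
      have : ∃ u ∈ Kᗮ, inner ℝ a₁ u ≠ 0 := by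
        by_contra! hall
        refine hnot ?_
        rw [SetLike.mem_coe, ← Submodule.orthogonal_orthogonal K, Submodule.mem_orthogonal']
        exact hall
      obtain ⟨u, huK, hu⟩ := this
      rcases lt_or_gt_of_ne hu with h | h
      · exact ⟨-u, Kᗮ.neg_mem huK, by simpa using h⟩
      · exact ⟨u, huK, h⟩
    rw [Submodule.mem_orthogonal] at huK
    have hu₀ : inner ℝ a₀ u = 0 :=
      huK a₀ (Submodule.mem_sup_left (Submodule.mem_span_singleton_self a₀))
    have huB : ∀ a ∈ B, inner ℝ a u = 0 := fun a ha =>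
      huK a (Submodule.mem_sup_right (Submodule.subset_span ha))
    obtain ⟨a₂, ha₂, hmin₂⟩ := Finset.exists_min_image (A.filter fun a => 0 < inner ℝ a u)
      (fun a => -inner ℝ a y / inner ℝ a u) ⟨a₁, Finset.mem_filter.2 ⟨ha₁, hu⟩⟩
    simp only [Finset.mem_filter] at ha₂ hmin₂
    set t : ℝ := -inner ℝ a₂ y / inner ℝ a₂ u with ht
    have ht0 : 0 ≤ t := div_nonneg (neg_nonneg.2 (hy a₂ ha₂.1)) ha₂.2.le
    have hw : ∀ a, inner ℝ a (y + t • u) = inner ℝ a y + t * inner ℝ a u := fun a => by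
      rw [inner_add_right, inner_smul_right]
    have hwF : y + t • u ∈ F := by
      refine ⟨fun a ha => ?_, a₀, ha₀, by rwa [hw, hu₀, mul_zero, add_zero]⟩
      rw [hw]
      by_cases hau : 0 < inner ℝ a u
      · have := (le_div_iff₀ hau).1 (hmin₂ a ⟨ha, hau⟩)
        linarith
      · have := mul_nonpos_of_nonneg_of_nonpos ht0 (not_lt.1 hau)
        linarith [hy a ha]
    refine absurd (hmin _ hwF) (not_le.2 (Finset.card_lt_card ?_))
    rw [Finset.ssubset_iff_of_subset]
    · refine ⟨a₂, ?_, ?_⟩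
      · simp only [Finset.mem_filter]
        exact ⟨ha₂.1, fun h => ha₂.2.ne' (huB a₂ ⟨ha₂.1, h⟩)⟩
      · have : inner ℝ a₂ (y + t • u) = 0 := by
          rw [hw, ht, div_mul_cancel₀ _ ha₂.2.ne']; ring
        simp [this]
    · intro a ha
      simp only [Finset.mem_filter] at ha ⊢
      refine ⟨ha.1, fun h => ha.2 ?_⟩
      rw [hw, h, huB a ⟨ha.1, h⟩]; ring
  calc finrank ℝ (Submodule.span ℝ (A : Set E))
      ≤ finrank ℝ ↥(Submodule.span ℝ {a₀} ⊔ Submodule.span ℝ B) := Submodule.finrank_mono hle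
    _ ≤ finrank ℝ (Submodule.span ℝ {a₀}) + finrank ℝ (Submodule.span ℝ B) :=
        Submodule.finrank_add_le_finrank_add_finrank _ _
    _ ≤ 1 + finrank ℝ (Submodule.span ℝ B) := by
        gcongr
        simpa using finrank_span_le_card ({a₀} : Set E)
    _ = _ := add_comm _ _

/-- A complete flag of faces of a full-dimensional polyhedral cone, recorded by directions `y`. -/
theorem exists_lexNeg_flag [FiniteDimensional ℝ E] (m : ℕ) (A : Finset E)
    (hz : ∃ z : E, ∀ a ∈ A, inner ℝ a z < 0)
    (hm : finrank ℝ (Submodule.span ℝ (A : Set E)) = m) :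
    ∃ y : Fin m → E, (∀ a ∈ A, LexNeg fun j => inner ℝ a (y j)) ∧
      ∀ j, ∃ a ∈ A, (∀ i < j, inner ℝ a (y i) = 0) ∧ inner ℝ a (y j) < 0 := by
  classical
  induction m generalizing A with
  | zero =>
    refine ⟨Fin.elim0, fun a ha => ?_, fun j => j.elim0⟩
    obtain ⟨z, hz⟩ := hz
    have : a = 0 := by
      have h := Submodule.finrank_eq_zero.1 hm
      simpa [h] using (Submodule.subset_span ha : a ∈ Submodule.span ℝ (A : Set E))
    simpa [this] using hz a ha
  | succ m ih =>
    have hA : A.Nonempty := by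
      by_contra h
      rw [Finset.not_nonempty_iff_eq_empty] at h
      rw [h, Finset.coe_empty, Submodule.span_empty, finrank_bot] at hm
      exact absurd hm.symm (Nat.succ_ne_zero m)
    obtain ⟨y₀, hy₀, hrank, a₀, ha₀, ha₀y⟩ := exists_extremal_direction A hA hz
    obtain ⟨z, hz⟩ := hz
    -- The normals tight at `y₀` have span of rank one less; they supply the rest of the flag, while
    -- every other normal is already negative on `y₀`.
    obtain ⟨y, hlex, htri⟩ := ih (A.filter fun a => inner ℝ a y₀ = 0)
      ⟨z, fun a ha => hz a (Finset.mem_filter.1 ha).1⟩ (by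
        rw [hm] at hrank
        rw [Finset.coe_filter]
        exact Nat.succ_injective hrank)
    refine ⟨Fin.cons y₀ y, fun a ha => ?_, fun j => ?_⟩
    · rcases (hy₀ a ha).lt_or_eq with h | h
      · exact ⟨0, fun i hi => absurd hi (Fin.not_lt_zero i), by simpa using h⟩
      · obtain ⟨j, hj, hneg⟩ := hlex a (Finset.mem_filter.2 ⟨ha, h⟩)
        refine ⟨j.succ, fun i hi => ?_, by simpa using hneg⟩
        induction i using Fin.cases with
        | zero => simpa using h
        | succ i => simpa using hj i (Fin.succ_lt_succ_iff.1 hi)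
    · induction j using Fin.cases with
      | zero => exact ⟨a₀, ha₀, fun i hi => absurd hi (Fin.not_lt_zero i), by simpa using ha₀y⟩
      | succ j =>
        obtain ⟨a, ha, hj, hneg⟩ := htri j
        rw [Finset.mem_filter] at ha
        refine ⟨a, ha.1, fun i hi => ?_, by simpa using hneg⟩
        induction i using Fin.cases with
        | zero => simpa using ha.2
        | succ i => simpa using hj i (Fin.succ_lt_succ_iff.1 hi)

end Normals

/-! ### Tangent cones of tiles and germs of signed flags -/

section Tiling

variable {n : ℕ}

local notation "E" => EuclideanSpace ℝ (Fin n)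

/-- `A` is a set of normals describing the tangent cone of `P` at `x`. -/
structure IsTangentNormals (P : Set (EuclideanSpace ℝ (Fin n))) (x : EuclideanSpace ℝ (Fin n))
    (A : Finset (EuclideanSpace ℝ (Fin n))) : Prop where
  ne_zero : ∀ a ∈ A, a ≠ 0
  inner_nonpos : ∀ y ∈ P, ∀ a ∈ A, inner ℝ a (y - x) ≤ 0
  eventually_mem : ∀ᶠ v in 𝓝 (0 : EuclideanSpace ℝ (Fin n)),
    (∀ a ∈ A, inner ℝ a v ≤ 0) → x + v ∈ P

theorem IsPolyhedron.exists_isTangentNormals {P : Set E} (hP : IsPolyhedron P) {x : E}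
    (hx : x ∈ P) : ∃ A, IsTangentNormals P x A := by
  classical
  obtain ⟨𝓗, hfin, hhalf, rfl⟩ := hP
  choose! a b ha hab using hhalf
  have hmem : ∀ H ∈ 𝓗, ∀ y, y ∈ H ↔ inner ℝ (a H) y ≤ b H := fun H hH y => by
    conv_lhs => rw [hab H hH]
    rfl
  refine ⟨(hfin.toFinset.filter fun H => inner ℝ (a H) x = b H).image a, ?_, ?_, ?_⟩
  · simp only [Finset.mem_image, Finset.mem_filter, Set.Finite.mem_toFinset]
    rintro _ ⟨H, ⟨hH, -⟩, rfl⟩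
    exact ha H hH
  · simp only [Finset.mem_image, Finset.mem_filter, Set.Finite.mem_toFinset]
    rintro y hy _ ⟨H, ⟨hH, htight⟩, rfl⟩
    rw [inner_sub_right, htight]
    linarith [(hmem H hH y).1 (hy H hH)]
  · have : ∀ᶠ v in 𝓝 (0 : E), ∀ H ∈ 𝓗, inner ℝ (a H) x ≠ b H → inner ℝ (a H) (x + v) < b H := by
      rw [eventually_all_finite hfin]
      intro H hH
      by_cases htight : inner ℝ (a H) x = b H
      · simp [htight]
      · have hlt : inner ℝ (a H) x < b H := lt_of_le_of_ne ((hmem H hH x).1 (hx H hH)) htight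
        have hc : ContinuousAt (fun v : E => inner ℝ (a H) (x + v)) 0 := by fun_prop
        filter_upwards [hc.eventually_lt continuousAt_const (by simpa using hlt)] with v hv _
        exact hv
    filter_upwards [this] with v hv htan H hH
    rw [hmem H hH]
    by_cases htight : inner ℝ (a H) x = b H
    · have := htan (a H) (Finset.mem_image_of_mem a (by simp [hH, htight]))
      rw [inner_add_right, htight]
      linarith
    · exact (hv H hH htight).le

namespace IsTangentNormals

variable {P : Set (EuclideanSpace ℝ (Fin n))} {x : EuclideanSpace ℝ (Fin n)}
  {A : Finset (EuclideanSpace ℝ (Fin n))}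

theorem eventually_mem_interior (h : IsTangentNormals P x A) :
    ∀ᶠ v in 𝓝 (0 : E), (∀ a ∈ A, inner ℝ a v < 0) → x + v ∈ interior P := by
  filter_upwards [eventually_eventually_nhds.2 h.eventually_mem] with v hv hneg
  have hopen : ∀ᶠ w in 𝓝 v, ∀ a ∈ A, inner ℝ a w < 0 := by
    rw [eventually_all_finset]
    intro a ha
    have hc : ContinuousAt (fun w : E => inner ℝ a w) v := by fun_prop
    exact hc.eventually_lt continuousAt_const (hneg a ha)
  have hmem : ∀ᶠ w in 𝓝 v, x + w ∈ P := by
    filter_upwards [hv, hopen] with w hw hw' using hw fun a ha => (hw' a ha).le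
  rw [mem_interior_iff_mem_nhds]
  have ht : Tendsto (fun y : E => y - x) (𝓝 (x + v)) (𝓝 v) := by
    have : ContinuousAt (fun y : E => y - x) (x + v) := by fun_prop
    simpa [ContinuousAt] using this
  filter_upwards [ht.eventually hmem] with y hy
  simpa using hy

/-- An interior point can be pushed a little along `a` without leaving `P`, so no constraint is
tight there. -/
theorem exists_inner_neg (h : IsTangentNormals P x A) (hP : (interior P).Nonempty) :
    ∃ z : E, ∀ a ∈ A, inner ℝ a z < 0 := by
  obtain ⟨q, hq⟩ := hP
  refine ⟨q - x, fun a ha => ?_⟩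
  have ht : Tendsto (fun ε : ℝ => q + ε • a) (𝓝[>] 0) (𝓝 q) := by
    have : ContinuousAt (fun ε : ℝ => q + ε • a) 0 := by fun_prop
    simpa using this.tendsto.mono_left nhdsWithin_le_nhds
  obtain ⟨ε, hε, hpos⟩ :=
    ((ht.eventually (mem_interior_iff_mem_nhds.1 hq)).and self_mem_nhdsWithin).exists
  have hpos : 0 < ε := hpos
  have h1 := h.inner_nonpos _ hε a ha
  have h2 : 0 < inner ℝ a a := real_inner_self_pos.2 (h.ne_zero a ha)
  rw [show q + ε • a - x = (q - x) + ε • a by abel, inner_add_right, inner_smul_right] at h1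
  linarith [mul_pos hpos h2]

/-- Small multiples of both `u` and `-u` stay in `P` from `x`, so the exposing functional vanishes
on `u`, and uniqueness of its maximum forces `u = 0`. -/
theorem eq_zero_of_isVertex (h : IsTangentNormals P x A) (hv : IsVertex P x) {u : E}
    (hu : ∀ a ∈ A, inner ℝ a u = 0) : u = 0 := by
  obtain ⟨-, l, hl⟩ := hv
  have key : ∀ w : E, (∀ a ∈ A, inner ℝ a w = 0) → l w ≤ 0 ∧ (0 ≤ l w → w = 0) := by
    intro w hw
    have ht : Tendsto (fun ε : ℝ => ε • w) (𝓝[>] 0) (𝓝 0) := by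
      have : ContinuousAt (fun ε : ℝ => ε • w) 0 := by fun_prop
      simpa using this.tendsto.mono_left nhdsWithin_le_nhds
    obtain ⟨ε, hε, hpos⟩ := ((ht.eventually h.eventually_mem).and self_mem_nhdsWithin).exists
    have hpos : 0 < ε := hpos
    have hmem := hε fun a ha => by rw [inner_smul_right, hw a ha, mul_zero]
    have h1 := (hl _ hmem).1
    have h2 := (hl _ hmem).2
    simp only [map_add, map_smul, smul_eq_mul] at h1 h2
    refine ⟨nonpos_of_mul_nonpos_right (by linarith) hpos, fun h0 => ?_⟩
    have := h2 (by linarith [mul_nonneg hpos.le h0])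
    simpa [hpos.ne'] using this
  have h1 := (key (-u) fun a ha => by simp [hu a ha]).1
  rw [map_neg] at h1
  exact (key u hu).2 (by linarith)

/-- Without a line, the sum of the tight normals would expose `x`: equality in the sum makes every
term zero. -/
theorem exists_line_of_not_isVertex (h : IsTangentNormals P x A) (hx : x ∈ P)
    (hv : ¬ IsVertex P x) : ∃ u : E, u ≠ 0 ∧ ∀ a ∈ A, inner ℝ a u = 0 := by
  by_contra! hcon
  refine hv ⟨hx, ∑ a ∈ A, innerSL ℝ a, fun y hy => ?_⟩
  have hsub : (∑ a ∈ A, innerSL ℝ a) y - (∑ a ∈ A, innerSL ℝ a) x =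
      ∑ a ∈ A, inner ℝ a (y - x) := by
    rw [← map_sub]
    simp
  have hle : ∑ a ∈ A, inner ℝ a (y - x) ≤ 0 := Finset.sum_nonpos (h.inner_nonpos y hy)
  refine ⟨by linarith, fun hge => ?_⟩
  have h0 : ∑ a ∈ A, inner ℝ a (y - x) = 0 := le_antisymm hle (by linarith)
  have hall := (Finset.sum_eq_zero_iff_of_nonpos (h.inner_nonpos y hy)).1 h0
  by_contra hne
  obtain ⟨a, ha, hne'⟩ := hcon (y - x) (sub_ne_zero.2 hne)
  exact hne' (hall a ha)

end IsTangentNormals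

/-- The displacement `∑ j, ε ^ (j + 1) * s j * y j` attached to a sign vector `s`. -/
def signedDisplacement (y : Fin n → EuclideanSpace ℝ (Fin n)) (s : Fin n → ℤˣ) (ε : ℝ) :
    EuclideanSpace ℝ (Fin n) :=
  ∑ j : Fin n, (ε ^ ((j : ℕ) + 1) * ((s j : ℤ) : ℝ)) • y j

theorem tendsto_signedDisplacement (y : Fin n → E) (s : Fin n → ℤˣ) :
    Tendsto (signedDisplacement y s) (𝓝[>] 0) (𝓝 0) := by
  have hc : Continuous (signedDisplacement y s) := by
    unfold signedDisplacement
    fun_prop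
  -- The exponents start at `1`, so every term vanishes at `ε = 0`.
  have h0 : signedDisplacement y s 0 = 0 := by simp [signedDisplacement]
  exact (h0 ▸ hc.tendsto 0).mono_left nhdsWithin_le_nhds

theorem inner_signedDisplacement (y : Fin n → E) (s : Fin n → ℤˣ) (ε : ℝ) (a : E) :
    inner ℝ a (signedDisplacement y s ε) =
      ∑ j : Fin n, ε ^ ((j : ℕ) + 1) * (((s j : ℤ) : ℝ) * inner ℝ a (y j)) := by
  simp [signedDisplacement, inner_sum, inner_smul_right, mul_assoc]

/-- The cone with normals `A` contains the germ of the signed flag `(y, s)`. -/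
def ContainsGerm (y : Fin n → EuclideanSpace ℝ (Fin n)) (A : Finset (EuclideanSpace ℝ (Fin n)))
    (s : Fin n → ℤˣ) : Prop :=
  ∀ a ∈ A, LexNeg fun j => ((s j : ℤ) : ℝ) * inner ℝ a (y j)

/-- Independent `y` span the space, so no normal vanishes on all of them. Each constraint is thus
eventually strict one way or the other, and the curve avoids the boundary of the cone. -/
theorem IsTangentNormals.eventually_mem_iff {P : Set E} {x : E} {A : Finset E}
    (h : IsTangentNormals P x A) {y : Fin n → E} (hy : LinearIndependent ℝ y) (s : Fin n → ℤˣ) :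
    ∀ᶠ ε in 𝓝[>] 0, (x + signedDisplacement y s ε ∈ P → ContainsGerm y A s) ∧
      (ContainsGerm y A s → x + signedDisplacement y s ε ∈ interior P) := by
  have ht := tendsto_signedDisplacement y s
  have hA : ∀ᶠ ε in 𝓝[>] (0 : ℝ), ∀ a ∈ A,
      (inner ℝ a (signedDisplacement y s ε) ≤ 0 →
        LexNeg fun j => ((s j : ℤ) : ℝ) * inner ℝ a (y j)) ∧
      ((LexNeg fun j => ((s j : ℤ) : ℝ) * inner ℝ a (y j)) →
        inner ℝ a (signedDisplacement y s ε) < 0) := by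
    rw [eventually_all_finset]
    intro a ha
    simp only [inner_signedDisplacement]
    set c : Fin n → ℝ := fun j => ((s j : ℤ) : ℝ) * inner ℝ a (y j) with hc
    by_cases hlex : LexNeg c
    · filter_upwards [hlex.eventually_sum_neg] with ε hε
      exact ⟨fun _ => hlex, fun _ => hε⟩
    · have hc0 : c ≠ 0 := by
        intro h0
        refine h.ne_zero a ha (eq_zero_of_inner_eq_zero_of_linearIndependent (by simp) hy
          fun j => ?_)
        have := congrFun h0 j
        simp only [hc, Pi.zero_apply, mul_eq_zero] at this
        rw [real_inner_comm]
        simpa using this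
      filter_upwards [((lexNeg_or_lexNeg_neg hc0).resolve_left
        hlex).eventually_sum_pos] with ε hε
      exact ⟨fun hle => absurd hε (not_lt.2 hle), fun hl => absurd hl hlex⟩
  filter_upwards [hA, ht.eventually h.eventually_mem_interior] with ε hε hint
  refine ⟨fun hmem a ha => (hε a ha).1 ?_, fun hg => hint fun a ha => (hε a ha).2 (hg a ha)⟩
  simpa using h.inner_nonpos _ hmem a ha

/-- A cone with a line contains the germ for one value of some sign iff for the other one. -/
theorem exists_flip_of_line {y : Fin n → E} {A : Finset E} {u : E} (hu : u ≠ 0)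
    (hA : ∀ a ∈ A, inner ℝ a u = 0) :
    ∃ m, ∀ s, ContainsGerm y A s → ContainsGerm y A (Function.update s m (-s m)) := by
  -- Some `m` is the leading index of no normal: otherwise one normal per index would form a
  -- triangular basis orthogonal to `u`. Flipping `s m` then changes no leading sign.
  have hex : ∃ m, ∀ a ∈ A, (∀ i < m, inner ℝ a (y i) = 0) → inner ℝ a (y m) = 0 := by
    by_contra! hcon
    choose a ha h0 hd using hcon
    exact hu (eq_zero_of_inner_eq_zero_of_linearIndependent (by simp)
      (linearIndependent_left_of_triangular h0 hd) fun j => hA _ (ha j))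
  obtain ⟨m, hm⟩ := hex
  refine ⟨m, fun s hs a ha => (hs a ha).of_eq_off (m := m) (fun h => ?_) (fun i hi => ?_)
    fun h => ?_⟩
  · rw [hm a ha fun i hi => by simpa using h i hi, mul_zero]
  · simp [hi]
  · have : inner ℝ a (y m) = 0 := by simpa using h
    simp [this]

/-- For each `j` some normal has its leading entry, a negative one, at `j`; this forces `s j = 1`.
-/
theorem containsGerm_iff_of_flag {y : Fin n → E} {A : Finset E}
    (hlex : ∀ a ∈ A, LexNeg fun j => inner ℝ a (y j))
    (htri : ∀ j, ∃ a ∈ A, (∀ i < j, inner ℝ a (y i) = 0) ∧ inner ℝ a (y j) < 0)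
    (s : Fin n → ℤˣ) : ContainsGerm y A s ↔ s = 1 := by
  constructor
  · intro hs
    funext j
    obtain ⟨a, ha, h0, hneg⟩ := htri j
    obtain ⟨k, hk, hkneg⟩ := hs a ha
    have hjk : k = j := by
      rcases lt_trichotomy k j with h | h | h
      · simp [h0 k h] at hkneg
      · exact h
      · have := hk j h
        simp [hneg.ne] at this
    subst hjk
    rcases Int.units_eq_one_or (s k) with e | e
    · exact e
    · simp only [e, Units.val_neg, Units.val_one, Int.cast_neg, Int.cast_one] at hkneg
      linarith
  · rintro rfl a ha
    simpa using hlex a ha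

theorem IsPolyhedron.isClosed {P : Set E} (hP : IsPolyhedron P) : IsClosed P := by
  obtain ⟨𝓗, -, hhalf, rfl⟩ := hP
  refine isClosed_sInter fun H hH => ?_
  obtain ⟨a, b, -, rfl⟩ := hhalf H hH
  exact isClosed_le (by fun_prop) continuous_const

theorem IsLocallyFiniteTiling.eventually_mem_of_mem {ι : Type*} {T : ι → Set E}
    (hT : IsLocallyFiniteTiling T) (x : E) : ∀ᶠ p in 𝓝 x, ∀ i, p ∈ T i → x ∈ T i := by
  have hfin := hT.2 _ (Metric.isBounded_ball (x := x) (r := 1))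
  have hev : ∀ᶠ p in 𝓝 x, ∀ i ∈ {i | (T i ∩ Metric.ball x 1).Nonempty}, p ∈ T i → x ∈ T i := by
    rw [eventually_all_finite hfin]
    intro i _
    by_cases hx : x ∈ T i
    · exact Eventually.of_forall fun _ _ => hx
    · filter_upwards [(hT.1.isPolytope i).1.isClosed.isOpen_compl.mem_nhds hx] with p hp hp'
      exact absurd hp' hp
  filter_upwards [hev, Metric.ball_mem_nhds x one_pos] with p hp hball i hi
  exact hp i ⟨p, hi, hball⟩ hi

/-- The tangent cones at `x` of the tiles through `x` partition the germs of a signed flag. -/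
theorem IsLocallyFiniteTiling.existsUnique_containsGerm {ι : Type*} {T : ι → Set E}
    (hT : IsLocallyFiniteTiling T) (x : E) (A : ι → Finset E)
    (hA : ∀ i, x ∈ T i → IsTangentNormals (T i) x (A i)) {y : Fin n → E}
    (hy : LinearIndependent ℝ y) (s : Fin n → ℤˣ) :
    ∃! i, x ∈ T i ∧ ContainsGerm y (A i) s := by
  have hfin : {i | x ∈ T i}.Finite := by
    simpa using hT.2 {x} Bornology.isBounded_singleton
  have ht : Tendsto (fun ε => x + signedDisplacement y s ε) (𝓝[>] 0) (𝓝 x) := by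
    simpa using (tendsto_signedDisplacement y s).const_add x
  have hev : ∀ᶠ ε in 𝓝[>] (0 : ℝ), ∀ i ∈ {i | x ∈ T i},
      (x + signedDisplacement y s ε ∈ T i → ContainsGerm y (A i) s) ∧
      (ContainsGerm y (A i) s → x + signedDisplacement y s ε ∈ interior (T i)) := by
    rw [eventually_all_finite hfin]
    exact fun i hi => (hA i hi).eventually_mem_iff hy s
  obtain ⟨ε, hε, hloc⟩ := (hev.and (ht.eventually (hT.eventually_mem_of_mem x))).exists
  obtain ⟨i, hi⟩ := Set.mem_iUnion.1
    (hT.1.covering ▸ Set.mem_univ (x + signedDisplacement y s ε))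
  have hgi := (hε i (hloc i hi)).1 hi
  refine ⟨i, ⟨hloc i hi, hgi⟩, fun k hk => ?_⟩
  by_contra hne
  -- Containing the germ puts the same point in the interiors of both tiles.
  exact Set.disjoint_left.1 (hT.1.packing hne) ((hε k hk.1).2 hk.2) ((hε i (hloc i hi)).2 hgi)

end Tiling

/-! ### Double counting of signed germs -/

theorem mainTheorem1 (n : ℕ) (hn : 1 ≤ n) {ι : Type*} (T : ι → Set (EuclideanSpace ℝ (Fin n)))
    (hT : IsLocallyFiniteTiling T) :
    ¬ ∃ x : EuclideanSpace ℝ (Fin n), ∃! i : ι, IsVertex (T i) x := by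
  classical
  rintro ⟨x, i₀, hi₀, huniq⟩
  have hx₀ : x ∈ T i₀ := hi₀.1
  have hexA : ∀ i, ∃ A, x ∈ T i → IsTangentNormals (T i) x A := fun i => by
    by_cases hx : x ∈ T i
    · obtain ⟨A, hA⟩ := (hT.1.isPolytope i).1.exists_isTangentNormals hx
      exact ⟨A, fun _ => hA⟩
    · exact ⟨∅, fun h => absurd h hx⟩
  choose A hA using hexA
  have hspan : Submodule.span ℝ (A i₀ : Set (EuclideanSpace ℝ (Fin n))) = ⊤ := by
    rw [← Submodule.orthogonal_eq_bot_iff, Submodule.eq_bot_iff]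
    intro u hu
    rw [Submodule.mem_orthogonal] at hu
    exact (hA i₀ hx₀).eq_zero_of_isVertex hi₀ fun a ha => hu a (Submodule.subset_span ha)
  obtain ⟨y, hlex, htri⟩ := exists_lexNeg_flag n (A i₀)
    ((hA i₀ hx₀).exists_inner_neg (hT.1.interior_nonempty i₀)) (by
      rw [hspan, finrank_top, finrank_euclideanSpace_fin])
  have hy : LinearIndependent ℝ y := by
    choose a ha h0 hneg using htri
    exact linearIndependent_right_of_triangular h0 fun j => (hneg j).ne
  have hfin : {i | x ∈ T i}.Finite := by
    simpa using hT.2 {x} Bornology.isBounded_singleton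
  let I := hfin.toFinset
  have hrow : ∀ s : Fin n → ℤˣ,
      ∑ i ∈ I, (if ContainsGerm y (A i) s then ((∏ j, s j : ℤˣ) : ℤ) else 0) =
        ((∏ j, s j : ℤˣ) : ℤ) := by
    intro s
    obtain ⟨i, ⟨hxi, hi⟩, hu⟩ := hT.existsUnique_containsGerm x A hA hy s
    rw [Finset.sum_eq_single_of_mem i (by simpa [I] using hxi), if_pos hi]
    intro k hk hne
    rw [if_neg fun hg => hne (hu k ⟨by simpa [I] using hk, hg⟩)]
  have hcol : ∀ i ∈ I, i ≠ i₀ →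
      ∑ s, (if ContainsGerm y (A i) s then ((∏ j, s j : ℤˣ) : ℤ) else 0) = 0 := by
    intro i hi hne
    have hxi : x ∈ T i := by simpa [I] using hi
    obtain ⟨u, hu, hline⟩ := (hA i hxi).exists_line_of_not_isVertex hxi fun hv => hne (huniq i hv)
    obtain ⟨m, hm⟩ := exists_flip_of_line (y := y) hu hline
    exact sum_sign_eq_zero_of_flip m _ hm
  have hcol₀ : ∑ s, (if ContainsGerm y (A i₀) s then ((∏ j, s j : ℤˣ) : ℤ) else 0) = 1 := by
    simp [containsGerm_iff_of_flag hlex htri]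
  -- Flipping coordinate `0` cancels everything; this coordinate exists because `n ≥ 1`.
  have htotal : ∑ s : Fin n → ℤˣ, ((∏ j, s j : ℤˣ) : ℤ) = 0 := by
    simpa using sum_sign_eq_zero_of_flip (⟨0, hn⟩ : Fin n) (fun _ => True) fun _ _ => trivial
  have := calc
    (0 : ℤ) = ∑ s : Fin n → ℤˣ, ((∏ j, s j : ℤˣ) : ℤ) := htotal.symm
    _ = ∑ i ∈ I, ∑ s, (if ContainsGerm y (A i) s then ((∏ j, s j : ℤˣ) : ℤ) else 0) := by
      rw [Finset.sum_comm]
      exact Finset.sum_congr rfl fun s _ => (hrow s).symm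
    _ = 1 := by rw [Finset.sum_eq_single_of_mem i₀ (by simpa [I] using hx₀) hcol, hcol₀]
  exact zero_ne_one this
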